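/- Let $K$ be a field, let $n\ge 1$ and $l\ge 2$ be integers, and let $H$ be a subgroup of the symmetric group $\mathrm{Sym}_n$ on $\{1,\dots,n\}$. Let $G=G_{n,l}(H)$ be the group presented with generators $x_1,\dots,x_n$ and relations $$x_{i_1}x_{i_2}\cdots x_{i_l}=x_{\sigma(i_1)}x_{\sigma(i_2)}\cdots x_{\sigma(i_l)}\qquad(\sigma\in H,\ i_1,\dots,i_l\in\{1,\dots,n\}),$$ and let $K[G]$ be its group algebra. For a finite-dimensional subspace $V$ of a $K$-algebra $A$ put $d_V(m)=\dim_K(K+V+V^2+\cdots+V^m)$. (a) If $H$ is transitive on $\{1,\dots,n\}$, then $K[G]$ is (left and right) Noetherian; it is a PI-algebra, i.e. it satisfies a nonzero polynomial identity in noncommuting variables with coefficients in $K$; its Gelfand–Kirillov dimension $\sup_V\limsup_{m\to\infty}\log d_V(m)/\log m$ (supremum over all finite-dimensional subspaces $V$ of $K[G]$) equals $1$; and its classical Krull dimension, i.e. the supremum of the lengths of chains of prime two-sided ideals, equals $1$. (b) If $H$ is not transitive on $\{1,\dots,n\}$, then $K[G]$ has exponential growth: $K[G]$ is a finitely generated $K$-algebra,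 and for every finite-dimensional subspace $V$ that generates $K[G]$ as a $K$-algebra, the functions $d_V(m)$ and $2^m$ are equivalent, where $f$ and $g$ are equivalent if there are positive integers $c,k$ with $f(m)\le c\,g(km)$ and $g(m)\le c\,f(km)$ for all sufficiently large $m$. -/

import Mathlib

noncomputable section

/-- The relators `x_{i_1} ⋯ x_{i_l} (x_{σ(i_1)} ⋯ x_{σ(i_l)})⁻¹`, for `σ ∈ H` and
`i_1, …, i_l ∈ {1, …, n}`, in the free group on `x_1, …, x_n`. -/
def permRelators (n l : ℕ) (H : Subgroup (Equiv.Perm (Fin n))) : Set (FreeGroup (Fin n)) :=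
  {r | ∃ σ ∈ H, ∃ i : Fin l → Fin n,
    r = (List.ofFn fun k => FreeGroup.of (i k)).prod *
      ((List.ofFn fun k => FreeGroup.of (σ (i k))).prod)⁻¹}

/-- The group `G_{n,l}(H)` presented by generators `x_1, …, x_n` and the relations
`x_{i_1} ⋯ x_{i_l} = x_{σ(i_1)} ⋯ x_{σ(i_l)}`. -/
abbrev PermGroup (n l : ℕ) (H : Subgroup (Equiv.Perm (Fin n))) : Type :=
  PresentedGroup (permRelators n l H)

/-- `A` is a PI-algebra over the field `K`: some nonzero polynomial in noncommuting variables
vanishes under every substitution of elements of `A` for the variables. -/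
def IsPIAlgebra (K : Type*) (A : Type*) [Field K] [Ring A] [Algebra K A] : Prop :=
  ∃ f : FreeAlgebra K ℕ, f ≠ 0 ∧ ∀ a : ℕ → A, FreeAlgebra.lift K a f = 0

/-- The growth function `d_V(m) = dim_K (K + V + V² + ⋯ + V^m)` of a subspace `V` of `A`
(meaningful for finite-dimensional `V`). -/
def growthFun {K : Type*} {A : Type*} [Field K] [Ring A] [Algebra K A]
    (V : Submodule K A) (m : ℕ) : ℕ :=
  Module.finrank K (⨆ i ∈ Finset.range (m + 1), V ^ i : Submodule K A)

/-- The Gelfand–Kirillov dimension: the supremum, over the finite-dimensional subspaces `V` of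
`A`, of `limsup_m (log d_V(m) / log m)`. -/
def gkDim (K : Type*) (A : Type*) [Field K] [Ring A] [Algebra K A] : EReal :=
  ⨆ V : {V : Submodule K A // V.FG},
    Filter.limsup
      (fun m : ℕ => ((Real.log (growthFun V.1 m : ℝ) / Real.log (m : ℝ) : ℝ) : EReal))
      Filter.atTop

/-- Asymptotic domination of growth functions: `f(m) ≤ c g(k m)` for almost all `m`,
for some positive integers `c` and `k`. -/
def GrowthLE (f g : ℕ → ℕ) : Prop :=
  ∃ c k : ℕ, 0 < c ∧ 0 < k ∧ ∀ᶠ m in Filter.atTop, f m ≤ c * g (k * m)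

/-- A finitely generated algebra has exponential growth if the growth function of each
finite-dimensional generating subspace is equivalent to `m ↦ 2 ^ m`. -/
def HasExponentialGrowth (K : Type*) (A : Type*) [Field K] [Ring A] [Algebra K A] : Prop :=
  Algebra.FiniteType K A ∧
    ∀ V : Submodule K A, V.FG → Algebra.adjoin K (V : Set A) = ⊤ →
      GrowthLE (growthFun V) (fun m => 2 ^ m) ∧ GrowthLE (fun m => 2 ^ m) (growthFun V)

/-- A prime ideal of a (noncommutative) ring: a proper two-sided ideal `P` such that
`a R b ⊆ P` implies `a ∈ P` or `b ∈ P`. -/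
def IsPrimeTwoSided {R : Type*} [Ring R] (P : TwoSidedIdeal R) : Prop :=
  P ≠ ⊤ ∧ ∀ a b : R, (∀ r : R, a * r * b ∈ P) → a ∈ P ∨ b ∈ P

/-- The classical Krull dimension: the supremum of the lengths of chains of prime
two-sided ideals. -/
def clKrullDim (R : Type*) [Ring R] : WithBot ℕ∞ :=
  Order.krullDim {P : TwoSidedIdeal R // IsPrimeTwoSided P}

end

/-! (a) By transitivity all the `x_i ^ l` coincide, so `z = x_j ^ l` is central. Comparing words
that differ in one letter gives `x_{σ(i)} = a_σ x_i` with `a_σ` independent of `i`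
(`SatisfiesPermRelations.apply_eq`), so `a_σ` is torsion. The words `j…j i j…j` yield
`SatisfiesPermRelations.commute`, and from it all conjugates of the `x_i x_j⁻¹` by powers of `x_j`
commute with each other. They are finitely many, since `z` is central, and torsion, so they generate
a finite abelian group; it contains the kernel of the degree map `G → ℤ`
(`SatisfiesPermRelations.finite_ker`).

Hence `K[G]` is a finite module over the Laurent polynomials in `z`, a central Noetherian ring whose
nonzero primes are maximal. This gives both Noetherian properties, a standard identity, and Krull
dimension at most 1 by incomparability of primes; the kernels of `K[G] → K[ℤ]` and of the
augmentation form a chain of length 1. Since the kernel of the degree is finite, the number of group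
elements of bounded degree grows linearly, so the Gelfand–Kirillov dimension is 1.

(b) Sending one orbit to one letter and everything else to another respects the relations and maps
`G` onto a free group of rank two, whose positive words force exponential growth. -/

/-- The positive words in the free group are pairwise distinct. -/
theorem FreeGroup.prod_map_of_injective {α : Type*} :
    Function.Injective fun w : List α => (w.map FreeGroup.of).prod := by
  classical
  have key : ∀ w : List α, (w.map FreeGroup.of).prod = FreeGroup.mk (w.map fun a => (a, true)) := by
    intro w
    induction w with
    | nil => rfl
    | cons a w ih => simp [ih, FreeGroup.of]
  have red : ∀ w : List α, (FreeGroup.mk (w.map fun a => (a, true))).toWord =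
      w.map fun a => (a, true) := by
    intro w
    rw [FreeGroup.toWord_mk]
    apply FreeGroup.IsReduced.reduce_eq
    unfold FreeGroup.IsReduced
    rw [List.isChain_map]
    induction w with
    | nil => simp
    | cons a w ih => cases w <;> simp_all
  intro w₁ w₂ h
  have h2 := congrArg FreeGroup.toWord h
  simp only [key, red] at h2
  exact List.map_injective_iff.2 (fun a b hab => (Prod.mk.inj hab).1) h2

/-! ### Growth functions and exponential growth -/

section GrowthFunctions

variable {K A : Type*} [Field K] [Ring A] [Algebra K A]

/-- Replaces the sum of powers by a single power, so that bounds become multiplicative in `m`. -/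
theorem growthSpace_eq_pow (V : Submodule K A) (m : ℕ) :
    (⨆ i ∈ Finset.range (m + 1), V ^ i : Submodule K A) = (1 ⊔ V) ^ m := by
  apply le_antisymm
  · refine iSup₂_le fun i hi => ?_
    exact (pow_le_pow_left' (le_sup_right : V ≤ 1 ⊔ V) i).trans
      (pow_le_pow_right' (le_sup_left : (1 : Submodule K A) ≤ 1 ⊔ V)
        (by simpa [Nat.lt_succ_iff] using hi))
  · induction m with
    | zero => simp
    | succ m ih =>
      rw [pow_succ]
      refine (mul_le_mul' ih (le_refl (1 ⊔ V))).trans ?_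
      rw [Submodule.mul_sup, mul_one]
      refine sup_le (biSup_mono fun i hi => by simp at hi ⊢; omega) ?_
      simp only [Submodule.iSup_mul]
      refine iSup₂_le fun i hi => ?_
      rw [← pow_succ]
      exact le_iSup₂_of_le (i + 1) (by simp at hi ⊢; omega) le_rfl

theorem growthFun_eq (V : Submodule K A) (m : ℕ) :
    growthFun V m = Module.finrank K ((1 ⊔ V) ^ m : Submodule K A) := by
  rw [growthFun, growthSpace_eq_pow]

theorem Submodule.FG.one_sup_pow {V : Submodule K A} (hV : V.FG) (m : ℕ) :
    ((1 ⊔ V) ^ m : Submodule K A).FG := by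
  refine Submodule.FG.pow (Submodule.FG.sup ?_ hV) m
  rw [Submodule.one_eq_span]
  exact Submodule.fg_span_singleton _

open scoped Pointwise in
theorem growthFun_le_pow {V : Submodule K A} (hV : V.FG) :
    ∃ d : ℕ, 0 < d ∧ ∀ m, growthFun V m ≤ d ^ m := by
  classical
  obtain ⟨s, rfl⟩ := hV
  refine ⟨(insert 1 s).card, Finset.card_pos.2 ⟨1, by simp⟩, fun m => ?_⟩
  rw [growthFun_eq, Submodule.one_eq_span, ← Submodule.span_union, Submodule.span_pow]
  have : (({1} ∪ (s : Set A)) ^ m) = (((insert 1 s) ^ m : Finset A) : Set A) := by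
    push_cast
    rfl
  rw [this]
  exact (finrank_span_finset_le_card _).trans Finset.card_pow_le

theorem exists_mem_one_sup_pow {V : Submodule K A} (hV : Algebra.adjoin K (V : Set A) = ⊤) (a : A) :
    ∃ k, a ∈ (1 ⊔ V) ^ k := by
  have mono : ∀ {i j : ℕ}, i ≤ j → (1 ⊔ V) ^ i ≤ (1 ⊔ V) ^ j := fun h =>
    pow_le_pow_right' (le_sup_left : (1 : Submodule K A) ≤ 1 ⊔ V) h
  have ha : a ∈ Algebra.adjoin K (V : Set A) := hV ▸ Algebra.mem_top
  induction ha using Algebra.adjoin_induction with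
  | mem x hx => exact ⟨1, by rw [pow_one]; exact Submodule.mem_sup_right hx⟩
  | algebraMap r => exact ⟨0, by rw [pow_zero]; exact Submodule.algebraMap_mem r⟩
  | add x y _ _ hx hy =>
    obtain ⟨i, hi⟩ := hx
    obtain ⟨j, hj⟩ := hy
    exact ⟨max i j, add_mem (mono (le_max_left _ _) hi) (mono (le_max_right _ _) hj)⟩
  | mul x y _ _ hx hy =>
    obtain ⟨i, hi⟩ := hx
    obtain ⟨j, hj⟩ := hy
    exact ⟨i + j, by rw [pow_add]; exact Submodule.mul_mem_mul hi hj⟩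

theorem card_le_finrank_of_of_mem {G : Type*} [Group G] {ι : Type*} [Fintype ι] {v : ι → G}
    (hv : Function.Injective v) {W : Submodule K (MonoidAlgebra K G)} (hW : W.FG)
    (hvW : ∀ i, MonoidAlgebra.of K G (v i) ∈ W) : Fintype.card ι ≤ Module.finrank K W := by
  have : Module.Finite K W := Module.Finite.iff_fg.2 hW
  have hli : LinearIndependent K fun g : G => (MonoidAlgebra.of K G g) := by
    exact (MonoidAlgebra.basis G K).linearIndependent
  have h2 : LinearIndependent K fun i => (⟨_, hvW i⟩ : W) :=
    LinearIndependent.of_comp W.subtype (hli.comp v hv)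
  exact h2.fintype_card_le_finrank

/-- A finitely generated group that maps onto a noncommutative free group has a group algebra of
exponential growth. -/
theorem hasExponentialGrowth_of_freeGroup {G : Type*} [Group G] [Group.FG G]
    (φ : G →* FreeGroup Bool) (g : Bool → G) (hg : ∀ b, φ (g b) = FreeGroup.of b) :
    HasExponentialGrowth K (MonoidAlgebra K G) := by
  refine ⟨inferInstance, fun V hV hgen => ⟨?_, ?_⟩⟩
  · obtain ⟨d, hd, h⟩ := growthFun_le_pow hV
    refine ⟨1, d, one_pos, hd, Filter.Eventually.of_forall fun m => (h m).trans ?_⟩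
    simp only [one_mul, pow_mul]
    exact Nat.pow_le_pow_left Nat.lt_two_pow_self.le m
  · obtain ⟨i, hi⟩ := exists_mem_one_sup_pow hgen (MonoidAlgebra.of K G (g true))
    obtain ⟨j, hj⟩ := exists_mem_one_sup_pow hgen (MonoidAlgebra.of K G (g false))
    have hk : ∀ b, MonoidAlgebra.of K G (g b) ∈ (1 ⊔ V) ^ (i + j + 1) := by
      intro b
      cases b
      · exact pow_le_pow_right' (le_sup_left : (1 : Submodule K _) ≤ 1 ⊔ V) (by omega) hj
      · exact pow_le_pow_right' (le_sup_left : (1 : Submodule K _) ≤ 1 ⊔ V) (by omega) hi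
    -- The `2 ^ m` words of length `m` in the two elements `g b` lie in the power `(i + j + 1) * m`.
    -- They are distinct, as their images under `φ` are distinct positive words, hence linearly
    -- independent.
    refine ⟨1, i + j + 1, one_pos, by omega, Filter.Eventually.of_forall fun m => ?_⟩
    rw [one_mul, growthFun_eq]
    have := card_le_finrank_of_of_mem (K := K)
      (v := fun w : List.Vector Bool m => (w.toList.map g).prod) ?_
      (hV.one_sup_pow ((i + j + 1) * m)) ?_
    · simpa using this
    · intro w₁ w₂ h
      have := congrArg φ h
      simp only [map_list_prod, List.map_map, Function.comp_def, hg] at this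
      exact List.Vector.toList_injective (FreeGroup.prod_map_of_injective this)
    · rintro ⟨w, rfl⟩
      simp only [List.Vector.toList_mk]
      induction w with
      | nil => simp [Submodule.one_eq_span, MonoidAlgebra.one_def]
      | cons b w ih =>
        rw [List.map_cons, List.prod_cons, map_mul, List.length_cons, mul_add, mul_one, add_comm,
          pow_add]
        exact Submodule.mul_mem_mul (hk b) ih

end GrowthFunctions

/-! ### Consequences of the relations; finiteness of the degree kernel -/

section PermutationRelations

variable {G : Type*} [Group G] {n l : ℕ} {H : Subgroup (Equiv.Perm (Fin n))}

/-- The family `x` satisfies the relations `x_{i_1} ⋯ x_{i_l} = x_{σ(i_1)} ⋯ x_{σ(i_l)}`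
for all `σ ∈ H`. -/
def SatisfiesPermRelations (l : ℕ) (H : Subgroup (Equiv.Perm (Fin n))) (x : Fin n → G) : Prop :=
  ∀ σ ∈ H, ∀ w : List (Fin n), w.length = l →
    (w.map x).prod = (w.map fun i => x (σ i)).prod

theorem List.prod_ofFn_getElem_map {α : Type*} (f : α → G) {w : List α} (hw : w.length = l) :
    (List.ofFn fun k : Fin l => f (w.get (k.cast hw.symm))).prod = (w.map f).prod := by
  subst hw
  congr 1
  conv_rhs => rw [← List.ofFn_get w, List.map_ofFn]
  rfl

theorem satisfiesPermRelations_of :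
    SatisfiesPermRelations l H (PresentedGroup.of : Fin n → PermGroup n l H) := by
  intro σ hσ w hw
  have h := PresentedGroup.one_of_mem (rels := permRelators n l H)
    ⟨σ, hσ, fun k => w.get (k.cast hw.symm), rfl⟩
  rw [map_mul, map_inv, mul_inv_eq_one, map_list_prod, map_list_prod, List.map_ofFn,
    List.map_ofFn] at h
  rw [← List.prod_ofFn_getElem_map _ hw, ← List.prod_ofFn_getElem_map _ hw]
  exact h

/-- A family satisfying the defining relations induces a homomorphism. -/
theorem exists_permGroup_hom {x : Fin n → G} (hx : SatisfiesPermRelations l H x) :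
    ∃ φ : PermGroup n l H →* G, ∀ i, φ (PresentedGroup.of i) = x i := by
  refine ⟨PresentedGroup.toGroup (f := x) ?_, fun i => PresentedGroup.toGroup.of _⟩
  rintro r ⟨σ, hσ, i, rfl⟩
  have := hx σ hσ (List.ofFn i) (by simp)
  rw [List.map_ofFn, List.map_ofFn] at this
  rw [map_mul, map_inv, mul_inv_eq_one, map_list_prod, map_list_prod, List.map_ofFn,
    List.map_ofFn]
  simpa [Function.comp_def] using this

variable {x : Fin n → G}

theorem SatisfiesPermRelations.pow_eq (hx : SatisfiesPermRelations l H x) {σ : Equiv.Perm (Fin n)}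
    (hσ : σ ∈ H) (j : Fin n) : x (σ j) ^ l = x j ^ l := by
  simpa using (hx σ hσ (List.replicate l j) (by simp)).symm

/-- The element `x_{σ(j)} x_j⁻¹` does not depend on `j`. -/
theorem SatisfiesPermRelations.apply_eq (hx : SatisfiesPermRelations l H x) (hl : 1 ≤ l)
    {σ : Equiv.Perm (Fin n)} (hσ : σ ∈ H) (i j : Fin n) :
    x (σ j) = x (σ i) * (x i)⁻¹ * x j := by
  obtain ⟨l, rfl⟩ := Nat.exists_eq_add_of_le' hl
  -- From here `l + 1` is the word length: the word `i…ij` is compared with `i…ii`.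
  have h1 := hx σ hσ (List.replicate l i ++ [j]) (by simp)
  have h2 := hx.pow_eq hσ i
  simp only [List.map_append, List.map_replicate, List.prod_append, List.prod_replicate,
    List.map_singleton, List.prod_singleton] at h1
  have h3 : x j = (x i ^ l)⁻¹ * x (σ i) ^ l * x (σ j) := by rw [mul_assoc, ← h1]; group
  have h4 : (x i ^ l)⁻¹ * x (σ i) ^ l = x i * (x (σ i))⁻¹ := by
    rw [inv_mul_eq_iff_eq_mul, ← mul_assoc, ← pow_succ, ← h2, pow_succ]; group
  rw [h3, h4]; group

/-- Applying `σ` is left multiplication by one fixed element, so its power of exponent `orderOf σ`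
fixes `x i`. -/
theorem SatisfiesPermRelations.isOfFinOrder (hx : SatisfiesPermRelations l H x) (hl : 1 ≤ l)
    {σ : Equiv.Perm (Fin n)} (hσ : σ ∈ H) (i : Fin n) : IsOfFinOrder (x (σ i) * (x i)⁻¹) := by
  have key : ∀ m : ℕ, (x (σ i) * (x i)⁻¹) ^ m * x i = x ((σ ^ m) i) := by
    intro m
    induction m with
    | zero => simp
    | succ m ih =>
      rw [pow_succ', mul_assoc, ih, ← hx.apply_eq hl hσ i, pow_succ', Equiv.Perm.mul_apply]
  refine isOfFinOrder_iff_pow_eq_one.2 ⟨orderOf σ, orderOf_pos σ, ?_⟩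
  have := key (orderOf σ)
  rwa [pow_orderOf_eq_one, Equiv.Perm.one_apply, mul_eq_right] at this

/-- The element `x_j⁻¹ x_i` commutes with `x_{σ(j)}^q x_j^{-q}` for `q ≤ l`. -/
theorem SatisfiesPermRelations.commute (hx : SatisfiesPermRelations l H x)
    {σ : Equiv.Perm (Fin n)} (hσ : σ ∈ H) (i j : Fin n) {q : ℕ} (hq : q ≤ l) :
    Commute ((x j)⁻¹ * x i) (x (σ j) ^ q * (x j ^ q)⁻¹) := by
  rcases hq.eq_or_lt with rfl | hq
  · rw [hx.pow_eq hσ, mul_inv_cancel]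
    exact Commute.one_right _
  obtain ⟨p, rfl⟩ := Nat.exists_eq_add_of_lt hq
  have hi : ∀ i, x j ^ p * (x i * x j ^ q) = x (σ j) ^ p * (x (σ i) * x (σ j) ^ q) := by
    intro i
    simpa using hx σ hσ (List.replicate p j ++ i :: List.replicate q j) (by simp; omega)
  -- Solving the relation for the word `j^p i j^q`, where `p + 1 + q = l`, gives a conjugate by `x
  -- i` that does not depend on `i`; the case `i = j` is then compared with the general one.
  have h1 : ∀ i, x i * (x (σ j) ^ q * (x j ^ q)⁻¹) * (x i)⁻¹ =
      x j * (x (σ j) ^ (p + 1))⁻¹ * x j ^ p := by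
    intro i
    have h := hi i
    rw [hx.apply_eq (by omega) hσ j i] at h
    rw [mul_inv_eq_iff_eq_mul, ← mul_assoc, mul_inv_eq_iff_eq_mul]
    have h3 : x j * (x (σ j) ^ (p + 1))⁻¹ * x j ^ p * x i * x j ^ q =
        x j * (x (σ j) ^ (p + 1))⁻¹ * (x j ^ p * (x i * x j ^ q)) := by group
    rw [h3, h, pow_succ]
    group
  have h2 := (h1 i).trans (h1 j).symm
  rw [mul_inv_eq_iff_eq_mul] at h2
  rw [commute_iff_eq, mul_assoc, inv_mul_eq_iff_eq_mul, h2]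
  group

theorem SatisfiesPermRelations.pow_mem_center (hx : SatisfiesPermRelations l H x)
    (hgen : Subgroup.closure (Set.range x) = ⊤) [MulAction.IsPretransitive H (Fin n)]
    (j : Fin n) : x j ^ l ∈ Subgroup.center G := by
  rw [← Subgroup.centralizer_univ, ← Subgroup.coe_top, ← hgen, Subgroup.centralizer_closure,
    Subgroup.mem_centralizer_iff]
  rintro _ ⟨i, rfl⟩
  obtain ⟨σ, hσ⟩ := MulAction.exists_smul_eq H j i
  have : x i ^ l = x j ^ l := by
    rw [← hσ]
    exact hx.pow_eq σ.2 j
  rw [← this]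
  exact (Commute.self_pow _ _).eq

/-- The conjugates of `x_i x_j⁻¹` under the powers of `x_j`. -/
def conjQuotient (x : Fin n → G) (j i : Fin n) (k : ℤ) : G :=
  x j ^ k * (x i * (x j)⁻¹) * (x j ^ k)⁻¹

theorem conj_conjQuotient (x : Fin n → G) (j i : Fin n) (k m : ℤ) :
    x j ^ m * conjQuotient x j i k * (x j ^ m)⁻¹ = conjQuotient x j i (k + m) := by
  simp only [conjQuotient]
  group

theorem SatisfiesPermRelations.conjQuotient_mod (hx : SatisfiesPermRelations l H x)
    (hgen : Subgroup.closure (Set.range x) = ⊤) [MulAction.IsPretransitive H (Fin n)]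
    (j i : Fin n) (k : ℤ) : conjQuotient x j i k = conjQuotient x j i (k % l) := by
  conv_lhs => rw [← Int.emod_add_mul_ediv k l]
  rw [← conj_conjQuotient, zpow_mul, zpow_natCast, mul_inv_eq_iff_eq_mul]
  exact ((Subgroup.mem_center_iff.1
    (Subgroup.zpow_mem _ (hx.pow_mem_center hgen j) (k / l))) _).symm

/-- After conjugation by a power of `x j` the first exponent is `-1`, and the second may be reduced
to `0 ≤ q < l`. The second element is then a quotient of `x_{i'}^r x_j^{-r}` for `r = q + 1` and `r
= q`, both at most `l`, so `SatisfiesPermRelations.commute` applies. -/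
theorem SatisfiesPermRelations.conjQuotient_commute (hx : SatisfiesPermRelations l H x)
    (hgen : Subgroup.closure (Set.range x) = ⊤) [MulAction.IsPretransitive H (Fin n)]
    (hl : 1 ≤ l) (j i i' : Fin n) (k k' : ℤ) :
    Commute (conjQuotient x j i k) (conjQuotient x j i' k') := by
  have base : ∀ m : ℤ, Commute (conjQuotient x j i (-1)) (conjQuotient x j i' m) := by
    intro m
    rw [hx.conjQuotient_mod hgen j i' m]
    have h0 : 0 ≤ m % l := Int.emod_nonneg _ (by omega)
    have h1 : m % l < l := Int.emod_lt_of_pos _ (by omega)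
    obtain ⟨q, hq⟩ := Int.eq_ofNat_of_zero_le h0
    rw [hq] at h1 ⊢
    obtain ⟨σ, hσ⟩ := MulAction.exists_smul_eq H j i'
    have e1 : conjQuotient x j i (-1) = (x j)⁻¹ * x i := by
      simp [conjQuotient, mul_assoc]
    have e2 : conjQuotient x j i' (q : ℤ) = (x i' ^ q * (x j ^ q)⁻¹)⁻¹ *
        (x i' ^ (q + 1) * (x j ^ (q + 1))⁻¹) := by
      rw [conjQuotient, zpow_natCast, pow_succ, pow_succ']
      group
    have hs : x (σ.1 j) = x i' := congrArg x hσ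
    rw [e1, e2]
    refine Commute.mul_right (Commute.inv_right ?_) ?_
    · rw [← hs]
      exact hx.commute σ.2 i j (by omega)
    · rw [← hs]
      exact hx.commute σ.2 i j (by omega)
  have h := (Commute.conj_iff (x j ^ (k + 1))).2 (base (k' - (k + 1)))
  rw [conj_conjQuotient, conj_conjQuotient] at h
  convert h using 2 <;> ring

/-- A finitely generated abelian torsion group is finite: exponents matter only modulo `l`, and each
generator is conjugate to some `x_{σ(j)} x_j⁻¹`. -/
theorem SatisfiesPermRelations.finite_closure (hx : SatisfiesPermRelations l H x)
    (hgen : Subgroup.closure (Set.range x) = ⊤) [MulAction.IsPretransitive H (Fin n)]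
    (hl : 1 ≤ l) (j : Fin n) :
    Finite (Subgroup.closure (Set.range fun p : Fin n × ℤ => conjQuotient x j p.1 p.2)) := by
  set S := Set.range fun p : Fin n × ℤ => conjQuotient x j p.1 p.2 with hS
  have hfin : S.Finite := by
    refine (Set.finite_range fun p : Fin n × Fin l => conjQuotient x j p.1 (p.2 : ℕ)).subset ?_
    rintro _ ⟨⟨i, k⟩, rfl⟩
    have h0 : 0 ≤ k % l := Int.emod_nonneg _ (by omega)
    have h1 : k % l < l := Int.emod_lt_of_pos _ (by omega)
    obtain ⟨q, hq⟩ := Int.eq_ofNat_of_zero_le h0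
    refine ⟨(i, ⟨q, by omega⟩), ?_⟩
    simp only
    rw [hx.conjQuotient_mod hgen j i k, hq]
  have hcomm : ∀ a ∈ S, ∀ b ∈ S, a * b = b * a := by
    rintro _ ⟨p, rfl⟩ _ ⟨q, rfl⟩
    exact hx.conjQuotient_commute hgen hl j _ _ _ _
  have hab := Subgroup.isMulCommutative_closure hcomm
  let _ : CommGroup (Subgroup.closure S) :=
    { (inferInstance : Group (Subgroup.closure S)) with mul_comm := hab.is_comm.comm }
  have : Group.FG (Subgroup.closure S) :=
    (Group.fg_iff_subgroup_fg _).2 ⟨hfin.toFinset, by simp⟩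
  have htors : ∀ g (hg : g ∈ Subgroup.closure S),
      IsOfFinOrder (⟨g, hg⟩ : Subgroup.closure S) := by
    intro g hg
    induction hg using Subgroup.closure_induction with
    | mem g hg =>
      rw [← Submonoid.isOfFinOrder_coe]
      obtain ⟨⟨i, k⟩, rfl⟩ := hg
      obtain ⟨σ, hσ⟩ := MulAction.exists_smul_eq H j i
      have h := hx.isOfFinOrder hl σ.2 j
      rw [show σ.1 j = i from hσ] at h
      exact (MulAut.conj (x j ^ k)).toMonoidHom.isOfFinOrder h
    | one => exact IsOfFinOrder.one
    | mul a b ha hb iha ihb => exact Commute.isOfFinOrder_mul (hab.is_comm.comm _ _) iha ihb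
    | inv a ha iha => exact iha.inv
  exact CommGroup.finite_of_fg_isMulTorsion (Subgroup.closure S) fun g => htors g.1 g.2

/-- The closure is normalized by `x j`, so every element of `G` is `a * x j ^ k` with `a` in the
closure. Its degree is `k`, so on the kernel only `a` remains. -/
theorem SatisfiesPermRelations.finite_ker (hx : SatisfiesPermRelations l H x)
    (hgen : Subgroup.closure (Set.range x) = ⊤) [MulAction.IsPretransitive H (Fin n)]
    (hl : 1 ≤ l) (j : Fin n) (φ : G →* Multiplicative ℤ)
    (hφ : ∀ i, φ (x i) = Multiplicative.ofAdd 1) : Finite φ.ker := by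
  set S := Set.range fun p : Fin n × ℤ => conjQuotient x j p.1 p.2 with hS
  have hfin := hx.finite_closure hgen hl j
  suffices φ.ker ≤ Subgroup.closure S from
    Finite.of_injective _ (Subgroup.inclusion_injective this)
  have hconj : ∀ m : ℤ, ∀ a ∈ Subgroup.closure S,
      x j ^ m * a * (x j ^ m)⁻¹ ∈ Subgroup.closure S := by
    intro m a ha
    suffices Subgroup.closure S ≤
        (Subgroup.closure S).comap (MulAut.conj (x j ^ m)).toMonoidHom from this ha
    rw [Subgroup.closure_le]
    rintro _ ⟨⟨i, k⟩, rfl⟩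
    refine Subgroup.subset_closure ⟨(i, k + m), ?_⟩
    exact (conj_conjQuotient x j i k m).symm
  have hmul : ∀ a ∈ Subgroup.closure S, ∀ k : ℤ, ∀ b ∈ Subgroup.closure S, ∀ m : ℤ,
      ∃ c ∈ Subgroup.closure S, a * x j ^ k * (b * x j ^ m) = c * x j ^ (k + m) := by
    intro a ha k b hb m
    refine ⟨_, mul_mem ha (hconj k b hb), ?_⟩
    rw [zpow_add]
    group
  have hmem : ∀ g : G, ∃ a ∈ Subgroup.closure S, ∃ k : ℤ, g = a * x j ^ k := by
    intro g
    have hg : g ∈ Subgroup.closure (Set.range x) := hgen ▸ Subgroup.mem_top g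
    induction hg using Subgroup.closure_induction with
    | mem g hg =>
      obtain ⟨i, rfl⟩ := hg
      exact ⟨conjQuotient x j i 0, Subgroup.subset_closure ⟨(i, 0), rfl⟩, 1, by
        simp [conjQuotient]⟩
    | one => exact ⟨1, one_mem _, 0, by simp⟩
    | mul a b _ _ iha ihb =>
      obtain ⟨a, ha, k, rfl⟩ := iha
      obtain ⟨b, hb, m, rfl⟩ := ihb
      obtain ⟨c, hc, h⟩ := hmul a ha k b hb m
      exact ⟨c, hc, k + m, h⟩
    | inv a _ iha =>
      obtain ⟨a, ha, k, rfl⟩ := iha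
      obtain ⟨c, hc, h⟩ := hmul 1 (one_mem _) (-k) a⁻¹ (inv_mem ha) 0
      refine ⟨c, hc, -k + 0, h ▸ ?_⟩
      group
  have hle : Subgroup.closure S ≤ φ.ker := by
    rw [Subgroup.closure_le]
    rintro _ ⟨⟨i, k⟩, rfl⟩
    simp [MonoidHom.mem_ker, conjQuotient, hφ]
  intro g hg
  obtain ⟨a, ha, k, rfl⟩ := hmem g
  have h1 : φ a = 1 := hle ha
  rw [MonoidHom.mem_ker, map_mul, h1, one_mul, map_zpow, hφ, ← ofAdd_zsmul] at hg
  have hk : k = 0 := by simpa using hg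
  simpa [hk] using ha

end PermutationRelations

/-! ### Prime ideals of finite algebras over a central subring -/

section PrimeRings

open TensorProduct

/-- A nonzero two-sided ideal of a prime Artinian ring contains the identity. -/
theorem one_mem_of_prime_of_isArtinianRing {D : Type*} [Ring D] [IsArtinianRing D]
    (hD : ∀ a b : D, (∀ r, a * r * b = 0) → a = 0 ∨ b = 0) (I : Ideal D)
    (hI : ∀ x ∈ I, ∀ r, x * r ∈ I) (hne : I ≠ ⊥) : (1 : D) ∈ I := by
  classical
  have hjac : Ring.jacobson D = ⊥ := by
    have hnil := IsSemiprimaryRing.isNilpotent (R := D)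
    by_contra h
    have hk := Nat.find_spec hnil
    have hmin := fun m => Nat.find_min hnil (m := m)
    set k := Nat.find hnil
    rcases k with _ | _ | k
    · rw [Submodule.pow_zero, Ideal.one_eq_top] at hk
      exact h (le_bot_iff.1 (le_top.trans hk.le))
    · exact h (by simpa [Submodule.pow_one] using hk)
    -- If `J ^ (k + 2) = 0` is the first vanishing power, a nonzero `a ∈ J ^ (k + 1)` satisfies `a D
    -- a ⊆ J ^ (2k + 2) = 0`, against primeness.
    · obtain ⟨a, ha, ha0⟩ := Submodule.exists_mem_ne_zero_of_ne_bot (hmin (k + 1) (by omega))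
      have : ∀ r, a * r * a = 0 := by
        intro r
        have h1 : a * (r * a) ∈ Ring.jacobson D ^ (k + 1) * Ring.jacobson D ^ (k + 1) :=
          Ideal.mul_mem_mul ha (Ideal.mul_mem_left _ r ha)
        rw [← Ideal.IsTwoSided.pow_add] at h1
        have h2 := Ideal.pow_le_pow_right (show k + 1 + 1 ≤ k + 1 + (k + 1) by omega) h1
        rw [hk] at h2
        rw [mul_assoc]
        simpa using h2
      rcases hD a a this with h | h <;> exact ha0 h
  have : IsSemisimpleRing D := IsArtinianRing.isSemisimpleRing_iff_jacobson.2 hjac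
  obtain ⟨e, he, rfl⟩ := IsSemisimpleRing.ideal_eq_span_idempotent I
  have h1 : ∀ r, e * r * (1 - e) = 0 := by
    intro r
    obtain ⟨s, hs⟩ := Ideal.mem_span_singleton'.1 (hI e (Ideal.mem_span_singleton_self e) r)
    rw [mul_sub, mul_one, ← hs, mul_assoc, he.eq, sub_self]
  rcases hD _ _ h1 with h | h
  · exact absurd (by simp [h]) hne
  · rw [sub_eq_zero.1 h]
    exact Ideal.mem_span_singleton_self _

/-- A nonzero two-sided ideal of a prime ring which is a finite module over a central domain
meets that domain nontrivially. -/
theorem exists_algebraMap_mem_of_prime {R B : Type*} [CommRing R] [IsDomain R] [Ring B]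
    [Algebra R B] [Module.Finite R B] (hinj : Function.Injective (algebraMap R B))
    (hB : ∀ a b : B, (∀ r, a * r * b = 0) → a = 0 ∨ b = 0) (I : TwoSidedIdeal B)
    (hne : ∃ b ∈ I, b ≠ 0) : ∃ r : R, r ≠ 0 ∧ algebraMap R B r ∈ I := by
  let F := FractionRing R
  let ι : B →ₗ[R] F ⊗[R] B := TensorProduct.mk R F B 1
  have hloc : IsLocalizedModule (nonZeroDivisors R) ι := inferInstance
  have hι : ∀ b b', ι (b * b') = ι b * ι b' := fun b b' => by simp [ι]
  -- A nonzero central element of a prime ring is regular, so `B` embeds in its localization `F ⊗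
  -- B`, a prime Artinian ring.
  have tf : ∀ (c : R) (b : B), c ≠ 0 → c • b = 0 → b = 0 := by
    intro c b hc h
    refine (hB (algebraMap R B c) b fun r => ?_).resolve_left
      fun h => hc (hinj (by rw [h, map_zero]))
    rw [Algebra.commutes, mul_assoc, ← Algebra.smul_def, h, mul_zero]
  have ιinj : ∀ b b', ι b = ι b' → b = b' := by
    intro b b' h
    obtain ⟨c, hc⟩ := (IsLocalizedModule.eq_iff_exists (nonZeroDivisors R) ι).1 h
    refine sub_eq_zero.1 (tf c _ (nonZeroDivisors.coe_ne_zero c) ?_)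
    rw [smul_sub]
    exact sub_eq_zero.2 hc
  have surj : ∀ d, ∃ (b : B) (s : R), s ≠ 0 ∧ s • d = ι b := by
    intro d
    obtain ⟨⟨b, s⟩, h⟩ := IsLocalizedModule.surj (nonZeroDivisors R) ι d
    exact ⟨b, s, nonZeroDivisors.coe_ne_zero s, h⟩
  have tfD : ∀ (s : R) (d : F ⊗[R] B), s ≠ 0 → s • d = 0 → d = 0 := by
    intro s d hs h
    rw [← algebraMap_smul F, smul_eq_zero] at h
    exact h.resolve_left fun h => hs (IsFractionRing.injective R F (by rw [h, map_zero]))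
  have hartin : IsArtinianRing (F ⊗[R] B) := IsArtinianRing.of_finite F _
  have hD : ∀ a b : F ⊗[R] B, (∀ r, a * r * b = 0) → a = 0 ∨ b = 0 := by
    intro d d' h
    obtain ⟨b, s, hs, hb⟩ := surj d
    obtain ⟨b', s', hs', hb'⟩ := surj d'
    have h1 : ∀ r, b * r * b' = 0 := by
      intro r
      apply ιinj
      rw [hι, hι, ← hb, ← hb', map_zero, smul_mul_assoc, mul_smul_comm, smul_mul_assoc, h,
        smul_zero, smul_zero]
    rcases hB b b' h1 with rfl | rfl
    · exact Or.inl (tfD s d hs (by rw [hb, map_zero]))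
    · exact Or.inr (tfD s' d' hs' (by rw [hb', map_zero]))
  have smul_mem : ∀ (r : R) (b), b ∈ I → r • b ∈ I := fun r b hb => by
    rw [Algebra.smul_def]
    exact I.mul_mem_left _ _ hb
  -- The extension of `I`, written with denominators cleared: `1 ∈ J` then says that a nonzero
  -- scalar lies in `I`.
  let J : Ideal (F ⊗[R] B) :=
    { carrier := {d | ∃ b ∈ I, ∃ s : R, s ≠ 0 ∧ s • d = ι b}
      zero_mem' := ⟨0, I.zero_mem, 1, one_ne_zero, by simp⟩
      add_mem' := by
        rintro d d' ⟨b, hb, s, hs, h⟩ ⟨b', hb', s', hs', h'⟩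
        refine ⟨s' • b + s • b', I.add_mem (smul_mem _ _ hb) (smul_mem _ _ hb'), s * s',
          mul_ne_zero hs hs', ?_⟩
        rw [map_add, map_smul, map_smul, ← h, ← h', smul_add, smul_smul, smul_smul, mul_comm s]
      smul_mem' := by
        rintro c d ⟨b, hb, s, hs, h⟩
        obtain ⟨b', s', hs', h'⟩ := surj c
        refine ⟨b' * b, I.mul_mem_left _ _ hb, s' * s, mul_ne_zero hs' hs, ?_⟩
        rw [hι, ← h, ← h', smul_eq_mul, smul_mul_smul_comm] }
  have hJ : ∀ x ∈ J, ∀ r, x * r ∈ J := by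
    rintro d ⟨b, hb, s, hs, h⟩ c
    obtain ⟨b', s', hs', h'⟩ := surj c
    refine ⟨b * b', I.mul_mem_right _ _ hb, s * s', mul_ne_zero hs hs', ?_⟩
    rw [hι, ← h, ← h', smul_mul_smul_comm]
  have hJne : J ≠ ⊥ := by
    obtain ⟨b, hb, hb0⟩ := hne
    intro h
    have : ι b ∈ J := ⟨b, hb, 1, one_ne_zero, one_smul _ _⟩
    rw [h, Ideal.mem_bot] at this
    exact hb0 (ιinj _ _ (by rw [this, map_zero]))
  obtain ⟨b, hb, s, hs, h⟩ := one_mem_of_prime_of_isArtinianRing hD J hJ hJne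
  refine ⟨s, hs, ?_⟩
  have : algebraMap R B s = b := ιinj _ _ (by
    rw [← h, Algebra.algebraMap_eq_smul_one, map_smul]
    rfl)
  rwa [this]

/-- Incomparability for prime ideals of a finite algebra over a central subring. -/
theorem IsPrimeTwoSided.exists_algebraMap_mem {R A : Type*} [CommRing R] [Ring A] [Algebra R A]
    [Module.Finite R A] {P Q : TwoSidedIdeal A} (hP : IsPrimeTwoSided P) (hPQ : P < Q) :
    ∃ r : R, algebraMap R A r ∈ Q ∧ algebraMap R A r ∉ P := by
  let π : A →ₐ[R] P.ringCon.Quotient :=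
    { P.ringCon.mk' with commutes' := fun _ => rfl }
  have hπ : Function.Surjective π := RingCon.mk'_surjective _
  have hπ0 : ∀ a, π a = 0 ↔ a ∈ P := fun a => by
    rw [TwoSidedIdeal.mem_iff]
    exact RingCon.eq _
  let B := P.ringCon.Quotient
  let p := RingHom.ker (algebraMap R B)
  let _ : Algebra (R ⧸ p) B := (RingHom.kerLift (algebraMap R B)).toAlgebra' (by
    rintro ⟨r⟩ b
    exact Algebra.commutes r b)
  have : IsScalarTower R (R ⧸ p) B := IsScalarTower.of_algebraMap_eq fun _ => rfl
  have : Module.Finite R B := Module.Finite.of_surjective π.toLinearMap hπ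
  have : Module.Finite (R ⧸ p) B := Module.Finite.of_restrictScalars_finite R _ _
  have hinj : Function.Injective (algebraMap (R ⧸ p) B) := RingHom.kerLift_injective _
  have hB : ∀ a b : B, (∀ r, a * r * b = 0) → a = 0 ∨ b = 0 := by
    intro a b h
    obtain ⟨a, rfl⟩ := hπ a
    obtain ⟨b, rfl⟩ := hπ b
    rw [hπ0, hπ0]
    refine hP.2 a b fun r => ?_
    rw [← hπ0, map_mul, map_mul]
    exact h (π r)
  have hnt : Nontrivial B := by
    refine ⟨1, 0, fun h => hP.1 ?_⟩
    rw [← map_one π, hπ0] at h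
    refine top_le_iff.1 fun x _ => ?_
    simpa using P.mul_mem_left x 1 h
  have hprime : p.IsPrime := by
    refine Ideal.isPrime_iff.2 ⟨RingHom.ker_ne_top _, fun {r s} h => ?_⟩
    simp only [p, RingHom.mem_ker] at h ⊢
    refine hB _ _ fun b => ?_
    rw [Algebra.commutes r b, mul_assoc, ← map_mul, h, mul_zero]
  obtain ⟨q, hq, hqP⟩ := SetLike.exists_of_lt hPQ
  let I : TwoSidedIdeal B := TwoSidedIdeal.mk' (π '' Q) ⟨0, Q.zero_mem, map_zero π⟩
    (by
      rintro _ _ ⟨x, hx, rfl⟩ ⟨y, hy, rfl⟩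
      exact ⟨x + y, Q.add_mem hx hy, map_add π x y⟩)
    (by
      rintro _ ⟨x, hx, rfl⟩
      exact ⟨-x, Q.neg_mem hx, map_neg π x⟩)
    (by
      rintro y _ ⟨x, hx, rfl⟩
      obtain ⟨y, rfl⟩ := hπ y
      exact ⟨y * x, Q.mul_mem_left y x hx, map_mul π y x⟩)
    (by
      rintro _ y ⟨x, hx, rfl⟩
      obtain ⟨y, rfl⟩ := hπ y
      exact ⟨x * y, Q.mul_mem_right x y hx, map_mul π x y⟩)
  have hI : ∀ b, b ∈ I ↔ b ∈ π '' Q := fun b => TwoSidedIdeal.mem_mk' ..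
  obtain ⟨r, hr0, hr⟩ := exists_algebraMap_mem_of_prime hinj hB I
    ⟨π q, (hI _).2 ⟨q, hq, rfl⟩, fun h => hqP ((hπ0 q).1 h)⟩
  obtain ⟨r, rfl⟩ := Ideal.Quotient.mk_surjective r
  obtain ⟨y, hy, hyr⟩ := (hI _).1 hr
  have hyr' : π y = π (algebraMap R A r) := hyr.trans (π.commutes r).symm
  have hmem : y - algebraMap R A r ∈ P := by
    rw [← hπ0, map_sub, hyr', sub_self]
  refine ⟨r, ?_, fun h => hr0 (hinj ?_)⟩
  · have := Q.sub_mem hy (hPQ.le hmem)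
    rwa [sub_sub_cancel] at this
  · rw [map_zero]
    exact (π.commutes r).symm.trans ((hπ0 _).2 h)

theorem IsPrimeTwoSided.comap_isPrime {R A : Type*} [CommRing R] [Ring A] [Algebra R A]
    {P : TwoSidedIdeal A} (hP : IsPrimeTwoSided P) :
    ∃ p : Ideal R, p.IsPrime ∧ ∀ r, r ∈ p ↔ algebraMap R A r ∈ P := by
  let p : Ideal R :=
    { carrier := {r | algebraMap R A r ∈ P}
      zero_mem' := by simp
      add_mem' := fun {a b} ha hb => by simpa using P.add_mem ha hb
      smul_mem' := fun c a ha => by simpa using P.mul_mem_left _ _ ha }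
  refine ⟨p, ?_, fun r => Iff.rfl⟩
  · refine Ideal.isPrime_iff.2 ⟨fun h => hP.1 ?_, fun {r s} h => hP.2 _ _ fun a => ?_⟩
    · have h1 : algebraMap R A 1 ∈ P := (Ideal.eq_top_iff_one _).1 h
      rw [map_one] at h1
      refine top_le_iff.1 fun x _ => ?_
      simpa using P.mul_mem_left x 1 h1
    · rw [Algebra.commutes r a, mul_assoc, ← map_mul]
      exact P.mul_mem_left _ _ h

/-- In a chain `P₀ < P < P₁`, incomparability makes the contraction of `P` nonzero, hence maximal,
hence equal to that of `P₁`; this contradicts incomparability for `P < P₁`. -/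
theorem clKrullDim_le_one (R : Type*) {A : Type*} [CommRing R] [IsDomain R]
    [Ring.DimensionLEOne R] [Ring A] [Algebra R A] [Module.Finite R A] : clKrullDim A ≤ 1 := by
  rw [clKrullDim, Order.krullDim_le_one_iff]
  rintro ⟨P, hP⟩
  by_contra! h
  obtain ⟨h1, h2⟩ := h
  obtain ⟨⟨P₀, hP₀⟩, h0 : P₀ < P⟩ := not_isMin_iff.1 h1
  obtain ⟨⟨P₁, hP₁⟩, h1 : P < P₁⟩ := not_isMax_iff.1 h2
  obtain ⟨p, hp, hpP⟩ := hP.comap_isPrime (R := R)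
  obtain ⟨p₁, hp₁, hpP₁⟩ := hP₁.comap_isPrime (R := R)
  obtain ⟨r, hr, hr'⟩ := hP₀.exists_algebraMap_mem (R := R) h0
  obtain ⟨s, hs, hs'⟩ := hP.exists_algebraMap_mem (R := R) h1
  have hne : p ≠ ⊥ := by
    rintro rfl
    have : r = 0 := (hpP r).2 hr
    rw [this, map_zero] at hr'
    exact hr' P₀.zero_mem
  have hmax := Ring.DimensionLEOne.maximalOfPrime hne hp
  have hle : p ≤ p₁ := fun x hx => (hpP₁ x).2 (h1.le ((hpP x).1 hx))
  have heq := hmax.eq_of_le hp₁.ne_top hle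
  exact hs' ((hpP s).1 (heq ▸ (hpP₁ s).2 hs))

theorem isPrimeTwoSided_ker {A B : Type*} [Ring A] [Ring B] [IsDomain B] (f : A →+* B) :
    IsPrimeTwoSided (TwoSidedIdeal.ker f) := by
  refine ⟨fun h => ?_, fun a b h => ?_⟩
  · have : (1 : A) ∈ TwoSidedIdeal.ker f := h ▸ trivial
    rw [TwoSidedIdeal.mem_ker, map_one] at this
    exact one_ne_zero this
  · have := h 1
    rw [mul_one] at this
    simpa only [TwoSidedIdeal.mem_ker, map_mul, mul_eq_zero] using this

theorem one_le_clKrullDim_of_hom {A B C : Type*} [Ring A] [Ring B] [IsDomain B] [Ring C]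
    [IsDomain C] (f : A →+* B) (g : B →+* C) (a : A) (ha : f a ≠ 0) (hga : g (f a) = 0) :
    1 ≤ clKrullDim A := by
  have hlt : TwoSidedIdeal.ker f < TwoSidedIdeal.ker (g.comp f) := by
    rw [SetLike.lt_iff_le_and_exists]
    refine ⟨fun x hx => ?_, a, ?_, ?_⟩
    · rw [TwoSidedIdeal.mem_ker] at hx ⊢
      simp [hx]
    · simpa [TwoSidedIdeal.mem_ker] using hga
    · simpa [TwoSidedIdeal.mem_ker] using ha
  have hlt' : (⟨_, isPrimeTwoSided_ker f⟩ : {P : TwoSidedIdeal A // IsPrimeTwoSided P}) <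
    ⟨_, isPrimeTwoSided_ker (g.comp f)⟩ := hlt
  exact Order.one_le_krullDim_iff.2 ⟨_, _, hlt'⟩

end PrimeRings

/-! ### Standard identities -/

section PolynomialIdentity

/-- The standard polynomial in `m` noncommuting variables. -/
def standardPolynomial (K : Type*) [Field K] (m : ℕ) : FreeAlgebra K ℕ :=
  ∑ σ : Equiv.Perm (Fin m), Equiv.Perm.sign σ •
    (List.ofFn fun i => FreeAlgebra.ι K ((σ i : Fin m) : ℕ)).prod

theorem standardPolynomial_ne_zero (K : Type*) [Field K] (m : ℕ) :
    standardPolynomial K m ≠ 0 := by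
  intro h
  have h1 := congrArg (FreeAlgebra.equivMonoidAlgebraFreeMonoid (R := K) (X := ℕ)) h
  have e₀ : ∀ w : List ℕ, FreeAlgebra.equivMonoidAlgebraFreeMonoid
      (w.map (FreeAlgebra.ι K)).prod = MonoidAlgebra.of K (FreeMonoid ℕ) (FreeMonoid.ofList w) := by
    intro w
    induction w with
    | nil => simp [MonoidAlgebra.one_def]
    | cons a w ih =>
      rw [List.map_cons, List.prod_cons, map_mul, ih, FreeMonoid.ofList_cons, map_mul]
      simp [FreeAlgebra.equivMonoidAlgebraFreeMonoid]
  have e : ∀ σ : Equiv.Perm (Fin m), FreeAlgebra.equivMonoidAlgebraFreeMonoid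
      (List.ofFn fun i => FreeAlgebra.ι K ((σ i : Fin m) : ℕ)).prod =
      MonoidAlgebra.of K (FreeMonoid ℕ)
        (FreeMonoid.ofList (List.ofFn fun i => ((σ i : Fin m) : ℕ))) := by
    intro σ
    rw [← e₀, List.map_ofFn]
    rfl
  have hli : LinearIndependent K fun g : FreeMonoid ℕ => (MonoidAlgebra.of K _ g) :=
    (MonoidAlgebra.basis (FreeMonoid ℕ) K).linearIndependent
  have hinj : Function.Injective fun σ : Equiv.Perm (Fin m) =>
      FreeMonoid.ofList (List.ofFn fun i => ((σ i : Fin m) : ℕ)) := by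
    intro σ τ h
    have := List.ofFn_injective (FreeMonoid.ofList.injective h)
    ext i
    exact congrFun this i
  have hli2 := hli.comp _ hinj
  rw [Fintype.linearIndependent_iff] at hli2
  -- The identity permutation has coefficient `1`, which is nonzero in every characteristic.
  have := hli2 (fun σ => ((Equiv.Perm.sign σ : ℤ) : K)) (by
    rw [standardPolynomial, map_sum, map_zero] at h1
    rw [← h1]
    refine Finset.sum_congr rfl fun σ _ => ?_
    rw [Units.smul_def, map_zsmul, e, Int.cast_smul_eq_zsmul]
    rfl) 1
  simp at this

/-- The identity has coefficients in `K`, but finiteness of `A` is over `R`; as the signs are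
integers, the same expression is `R`-multilinear. -/
theorem lift_standardPolynomial {K R A : Type*} [Field K] [CommRing R] [Ring A] [Algebra K A]
    [Algebra R A] (m : ℕ) (a : ℕ → A) :
    FreeAlgebra.lift K a (standardPolynomial K m) =
      MultilinearMap.alternatization (MultilinearMap.mkPiAlgebraFin R m A)
        fun i : Fin m => a i := by
  rw [MultilinearMap.alternatization_apply, standardPolynomial, map_sum]
  refine Finset.sum_congr rfl fun σ _ => ?_
  rw [Units.smul_def, Units.smul_def, map_zsmul, map_list_prod, List.map_ofFn]
  simp [Function.comp_def]

/-- A finite algebra over a central subring is a PI-algebra. -/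
theorem isPIAlgebra_of_finite (K R : Type*) {A : Type*} [Field K] [CommRing R] [Ring A]
    [Algebra K A] [Algebra R A] [Module.Finite R A] : IsPIAlgebra K A := by
  obtain ⟨N, f, hf⟩ := Module.Finite.exists_fin' R A
  refine ⟨standardPolynomial K (N + 1), standardPolynomial_ne_zero K _, fun a => ?_⟩
  rw [lift_standardPolynomial (R := R)]
  choose b hb using fun i => hf (a i)
  -- An alternating map in `N + 1` arguments vanishes on a free module of rank `N`.
  have h0 : (MultilinearMap.alternatization
      (MultilinearMap.mkPiAlgebraFin R (N + 1) A)).compLinearMap f = 0 := by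
    refine (Pi.basisFun R (Fin N)).ext_alternating fun v hv => ?_
    exact absurd (Fintype.card_le_of_injective v hv) (by simp)
  have := congrArg (fun g => g fun i : Fin (N + 1) => b i) h0
  simpa [AlternatingMap.compLinearMap_apply, hb] using this

end PolynomialIdentity

/-! ### Noetherian properties and Laurent polynomials -/

section Noetherian

theorem isNoetherianRing_mulOpposite_of_finite (R : Type*) {A : Type*} [CommRing R]
    [IsNoetherianRing R] [Ring A] [Algebra R A] [Module.Finite R A] : IsNoetherianRing Aᵐᵒᵖ := by
  have : Module.Finite R Aᵐᵒᵖ := Module.Finite.equiv (MulOpposite.opLinearEquiv R)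
  exact IsNoetherianRing.of_finite R Aᵐᵒᵖ

open LaurentPolynomial

theorem isNoetherianRing_laurentPolynomial (K : Type*) [Field K] : IsNoetherianRing K[T;T⁻¹] :=
  IsLocalization.isNoetherianRing (Submonoid.powers (Polynomial.X : Polynomial K)) _ inferInstance

theorem dimensionLEOne_laurentPolynomial (K : Type*) [Field K] :
    Ring.DimensionLEOne K[T;T⁻¹] :=
  Ring.DimensionLEOne.localization (M := Submonoid.powers (Polynomial.X : Polynomial K)) _
    (powers_le_nonZeroDivisors_of_noZeroDivisors Polynomial.X_ne_zero)

end Noetherian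

/-! ### Group algebras of groups with a degree map of finite kernel -/

section FiniteByCyclic

variable {G : Type*} [Group G]

theorem Finite.preimage_of_finite_ker {M : Type*} [Group M] (φ : G →* M) [Finite φ.ker]
    {s : Set M} (hs : s.Finite) : (φ ⁻¹' s).Finite := by
  refine hs.preimage' fun b _ => ?_
  by_cases hb : ∃ g, φ g = b
  · obtain ⟨g, rfl⟩ := hb
    refine ((Set.toFinite (φ.ker : Set G)).image (g * ·)).subset fun x hx => ?_
    refine ⟨g⁻¹ * x, ?_, by simp⟩
    have hx : φ x = φ g := hx
    simp [MonoidHom.mem_ker, hx]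
  · convert Set.finite_empty
    rw [Set.eq_empty_iff_forall_notMem]
    exact fun x hx => hb ⟨x, hx⟩

section Central

open LaurentPolynomial

variable (K : Type*) [Field K]

/-- The group algebra as an algebra over Laurent polynomials, the variable acting as a
central element of the group. -/
noncomputable abbrev laurentAlgebra {z : G} (hz : z ∈ Subgroup.center G) :
    Algebra K[T;T⁻¹] (MonoidAlgebra K G) :=
  (AddMonoidAlgebra.lift K (MonoidAlgebra K G) ℤ
    ((MonoidAlgebra.of K G).comp (zpowersHom G z))).toRingHom.toAlgebra' (by
      intro p a
      change Commute _ a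
      induction a using MonoidAlgebra.induction_on with
      | of g =>
        induction p using LaurentPolynomial.induction_on' with
        | add p q hp hq => rw [map_add]; exact hp.add_left hq
        | C_mul_T n r =>
          rw [← LaurentPolynomial.single_eq_C_mul_T]
          change Commute (AddMonoidAlgebra.lift K _ ℤ _ (AddMonoidAlgebra.single n r)) _
          rw [AddMonoidAlgebra.lift_single]
          have h := Subgroup.mem_center_iff.1 (Subgroup.zpow_mem _ hz n) g
          simp [commute_iff_eq, h]
      | add a b ha hb => exact ha.add_right hb
      | smul r a ha => exact ha.smul_right r)

/-- Division with remainder by the degree `m` of `z`: each `g` is a power of `z` times an element of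
degree in `[0, |m|)`, and there are finitely many of those. -/
theorem finite_laurentAlgebra {z : G} (hz : z ∈ Subgroup.center G) (φ : G →* Multiplicative ℤ)
    [Finite φ.ker] (hφ : φ z ≠ 1) :
    letI := laurentAlgebra K hz
    Module.Finite K[T;T⁻¹] (MonoidAlgebra K G) := by
  let _ := laurentAlgebra K hz
  set m := (φ z).toAdd with hm
  have hm0 : m ≠ 0 := fun h => hφ (by rw [← ofAdd_toAdd (φ z), ← hm, h]; rfl)
  have hfin : (φ ⁻¹' (Multiplicative.toAdd ⁻¹' Set.Ico 0 |m|)).Finite :=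
    Finite.preimage_of_finite_ker φ ((Set.finite_Ico 0 |m|).preimage
      Multiplicative.toAdd.injective.injOn)
  have hsm : ∀ (k : ℤ) (g : G), (T k : K[T;T⁻¹]) • MonoidAlgebra.of K G g =
      MonoidAlgebra.of K G (z ^ k * g) := by
    intro k g
    rw [Algebra.smul_def, map_mul]
    congr 1
    change AddMonoidAlgebra.lift K _ ℤ _ (AddMonoidAlgebra.single k 1) = _
    rw [AddMonoidAlgebra.lift_single]
    simp
  refine ⟨⟨(hfin.image (MonoidAlgebra.of K G)).toFinset, ?_⟩⟩
  rw [Set.Finite.coe_toFinset, eq_top_iff]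
  intro a _
  induction a using MonoidAlgebra.induction_on with
  | of g =>
    have : MonoidAlgebra.of K G g = (T ((φ g).toAdd / m) : K[T;T⁻¹]) •
        MonoidAlgebra.of K G ((z ^ ((φ g).toAdd / m))⁻¹ * g) := by
      rw [hsm, mul_inv_cancel_left]
    rw [this]
    refine Submodule.smul_mem _ _ (Submodule.subset_span ⟨_, ?_, rfl⟩)
    have e : (φ ((z ^ ((φ g).toAdd / m))⁻¹ * g)).toAdd = (φ g).toAdd % m := by
      rw [map_mul, map_inv, map_zpow, toAdd_mul, toAdd_inv, toAdd_zpow, ← hm, Int.emod_def,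
        smul_eq_mul]
      ring
    simp only [Set.mem_preimage, e, Set.mem_Ico]
    exact ⟨Int.emod_nonneg _ hm0, Int.emod_lt_abs _ hm0⟩
  | add a b ha hb => exact add_mem (ha trivial) (hb trivial)
  | smul r a ha =>
    have : r • a = (C r : K[T;T⁻¹]) • a := by
      rw [Algebra.smul_def, Algebra.smul_def]
      congr 1
      exact ((AddMonoidAlgebra.lift K (MonoidAlgebra K G) ℤ _).commutes r).symm
    rw [this]
    exact Submodule.smul_mem _ _ (ha trivial)

end Central

/-! ### Linear growth and the Gelfand–Kirillov dimension -/

section Growth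

variable {K : Type*} [Field K]

theorem le_growthFun_span_of {x : G} (hx : ¬ IsOfFinOrder x) (m : ℕ) :
    m + 1 ≤ growthFun (Submodule.span K {MonoidAlgebra.of K G x}) m := by
  have hfg : (Submodule.span K {MonoidAlgebra.of K G x}).FG := Submodule.fg_span_singleton _
  rw [growthFun_eq]
  have := card_le_finrank_of_of_mem (K := K) (v := fun i : Fin (m + 1) => x ^ (i : ℕ)) ?_
    (hfg.one_sup_pow m) ?_
  · simpa using this
  · exact fun i j h => Fin.ext (injective_pow_iff_not_isOfFinOrder.2 hx h)
  · intro i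
    refine pow_le_pow_right' (le_sup_left : (1 : Submodule K (MonoidAlgebra K G)) ≤ _)
      (Nat.lt_succ_iff.1 i.2) ?_
    rw [map_pow]
    exact Submodule.pow_mem_pow _
      (Submodule.mem_sup_right (Submodule.mem_span_singleton_self _)) _

/-- The span of the group elements of degree at most `k` in absolute value. -/
noncomputable def degreeSpan (K : Type*) [Field K] (φ : G →* Multiplicative ℤ) (k : ℕ) :
    Submodule K (MonoidAlgebra K G) :=
  Submodule.span K (MonoidAlgebra.of K G '' {g | |(φ g).toAdd| ≤ k})

theorem degreeSpan_mul_le (φ : G →* Multiplicative ℤ) (k m : ℕ) :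
    degreeSpan K φ k * degreeSpan K φ m ≤ degreeSpan K φ (k + m) := by
  rw [degreeSpan, degreeSpan, Submodule.span_mul_span]
  refine Submodule.span_mono ?_
  rintro _ ⟨_, ⟨g, hg, rfl⟩, _, ⟨h, hh, rfl⟩, rfl⟩
  refine ⟨g * h, ?_, map_mul _ _ _⟩
  simp only [Set.mem_ofPred_eq, map_mul, toAdd_mul] at hg hh ⊢
  push_cast
  exact (abs_add_le _ _).trans (add_le_add hg hh)

theorem degreeSpan_mono (φ : G →* Multiplicative ℤ) : Monotone (degreeSpan K φ) := by
  intro k m h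
  refine Submodule.span_mono (Set.image_mono fun g hg => ?_)
  simp only [Set.mem_ofPred_eq] at hg ⊢
  exact hg.trans (by exact_mod_cast h)

theorem one_le_degreeSpan (φ : G →* Multiplicative ℤ) (k : ℕ) : 1 ≤ degreeSpan K φ k := by
  rw [Submodule.one_le]
  exact Submodule.subset_span ⟨1, by simp, map_one _⟩

theorem degreeSpan_pow_le (φ : G →* Multiplicative ℤ) (k m : ℕ) :
    degreeSpan K φ k ^ m ≤ degreeSpan K φ (k * m) := by
  induction m with
  | zero => simpa using one_le_degreeSpan φ 0
  | succ m ih =>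
    rw [pow_succ, mul_add, mul_one]
    exact (mul_le_mul' ih le_rfl).trans (degreeSpan_mul_le φ _ _)

theorem exists_le_degreeSpan (φ : G →* Multiplicative ℤ) {V : Submodule K (MonoidAlgebra K G)}
    (hV : V.FG) : ∃ k, V ≤ degreeSpan K φ k := by
  have key : ∀ a : MonoidAlgebra K G, ∃ k, a ∈ degreeSpan K φ k := by
    intro a
    induction a using MonoidAlgebra.induction_on with
    | of g => exact ⟨_, Submodule.subset_span ⟨g, (Int.natCast_natAbs (φ g).toAdd).ge, rfl⟩⟩
    | add a b ha hb =>
      obtain ⟨k, hk⟩ := ha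
      obtain ⟨m, hm⟩ := hb
      exact ⟨max k m, add_mem (degreeSpan_mono φ (le_max_left _ _) hk)
        (degreeSpan_mono φ (le_max_right _ _) hm)⟩
    | smul r a ha =>
      obtain ⟨k, hk⟩ := ha
      exact ⟨k, Submodule.smul_mem _ _ hk⟩
  obtain ⟨s, rfl⟩ := hV
  choose k hk using key
  refine ⟨s.sup k, Submodule.span_le.2 fun a ha => ?_⟩
  exact degreeSpan_mono φ (Finset.le_sup (f := k) ha) (hk a)

theorem finite_degree_le (φ : G →* Multiplicative ℤ) [Finite φ.ker] (k : ℕ) :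
    {g | |(φ g).toAdd| ≤ (k : ℤ)}.Finite ∧
      {g | |(φ g).toAdd| ≤ (k : ℤ)}.ncard ≤ (2 * k + 1) * Nat.card φ.ker := by
  classical
  have heq : {g | |(φ g).toAdd| ≤ (k : ℤ)} =
      φ ⁻¹' (Multiplicative.toAdd ⁻¹' (Finset.Icc (-k : ℤ) k : Set ℤ)) := by
    ext g
    simp [abs_le]
  have hfin : {g | |(φ g).toAdd| ≤ (k : ℤ)}.Finite := by
    rw [heq]
    exact Finite.preimage_of_finite_ker φ ((Finset.finite_toSet _).preimage
      Multiplicative.toAdd.injective.injOn)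
  refine ⟨hfin, ?_⟩
  have himage : (hfin.toFinset.image fun g => (φ g).toAdd) ⊆ Finset.Icc (-k : ℤ) k := by
    intro i hi
    obtain ⟨g, hg, rfl⟩ := Finset.mem_image.1 hi
    simpa [abs_le] using hg
  have hcard : (Finset.Icc (-k : ℤ) k).card = 2 * k + 1 := by
    rw [Int.card_Icc]
    omega
  rw [Set.ncard_eq_toFinset_card _ hfin, mul_comm, ← hcard]
  refine (Finset.card_le_mul_card_image (f := fun g => (φ g).toAdd) _ (Nat.card φ.ker) ?_).trans
    (Nat.mul_le_mul_left _ (Finset.card_le_card himage))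
  intro i hi
  obtain ⟨g, -, rfl⟩ := Finset.mem_image.1 hi
  rw [← Set.ncard_coe_finset, ← SetLike.coe_sort_coe, Nat.card_coe_set_eq]
  refine Set.ncard_le_ncard_of_injOn (g⁻¹ * ·) (fun h hh => ?_) (mul_right_injective _).injOn
    (Set.toFinite _)
  have : φ h = φ g := by simpa using (Finset.mem_filter.1 (Finset.mem_coe.1 hh)).2
  simp [MonoidHom.mem_ker, this]

theorem finrank_degreeSpan_le (φ : G →* Multiplicative ℤ) [Finite φ.ker] (k : ℕ) :
    (degreeSpan K φ k).FG ∧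
      Module.finrank K (degreeSpan K φ k) ≤ (2 * k + 1) * Nat.card φ.ker := by
  classical
  obtain ⟨hfin, hcard⟩ := finite_degree_le φ k
  have hfin' := hfin.image (MonoidAlgebra.of K G)
  refine ⟨Submodule.fg_span hfin', ?_⟩
  rw [degreeSpan, ← hfin'.coe_toFinset]
  refine (finrank_span_finset_le_card _).trans (le_trans ?_ hcard)
  rw [← Set.ncard_eq_toFinset_card _ hfin']
  exact Set.ncard_image_le hfin

theorem exists_growthFun_le (φ : G →* Multiplicative ℤ) [Finite φ.ker]
    {V : Submodule K (MonoidAlgebra K G)} (hV : V.FG) :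
    ∃ C : ℕ, 0 < C ∧ ∀ m, 1 ≤ m → growthFun V m ≤ C * m := by
  obtain ⟨k, hk⟩ := exists_le_degreeSpan φ hV
  refine ⟨(2 * k + 1) * Nat.card φ.ker, Nat.mul_pos (by omega) Nat.card_pos, fun m hm => ?_⟩
  obtain ⟨hfg, hcard⟩ := finrank_degreeSpan_le (K := K) φ (k * m)
  have := Module.Finite.iff_fg.2 hfg
  rw [growthFun_eq]
  calc _ ≤ Module.finrank K (degreeSpan K φ (k * m)) :=
        Submodule.finrank_mono ((pow_le_pow_left' (sup_le (one_le_degreeSpan φ k) hk) m).trans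
          (degreeSpan_pow_le φ k m))
    _ ≤ _ := hcard
    _ ≤ (2 * k + 1) * m * Nat.card φ.ker := by gcongr; nlinarith
    _ = _ := by ring

theorem gkDim_eq_one (φ : G →* Multiplicative ℤ) [Finite φ.ker] {x : G} (hx : ¬ IsOfFinOrder x) :
    gkDim K (MonoidAlgebra K G) = 1 := by
  apply le_antisymm
  · refine iSup_le fun ⟨V, hV⟩ => ?_
    obtain ⟨c, hc, h⟩ := exists_growthFun_le φ hV
    have hlim : Filter.Tendsto
        (fun m : ℕ => ((Real.log c / Real.log m + 1 : ℝ) : EReal)) Filter.atTop (nhds 1) := by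
      have : Filter.Tendsto (fun m : ℕ => (Real.log c / Real.log m + 1 : ℝ)) Filter.atTop
          (nhds (0 + 1)) :=
        (Filter.Tendsto.const_div_atTop
          (Real.tendsto_log_atTop.comp tendsto_natCast_atTop_atTop) _).add_const 1
      rw [zero_add] at this
      exact (continuous_coe_real_ereal.tendsto 1).comp this
    rw [← hlim.limsup_eq]
    refine Filter.limsup_le_limsup ?_
    -- `m ≥ 2` makes `log m` positive, avoiding division by zero.
    filter_upwards [Filter.eventually_ge_atTop 2] with m hm
    have hlog : 0 < Real.log m := Real.log_pos (by exact_mod_cast hm)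
    rw [EReal.coe_le_coe_iff, div_add_one hlog.ne', div_le_div_iff_of_pos_right hlog,
      ← Real.log_mul (by positivity) (by positivity)]
    rcases (growthFun V m).eq_zero_or_pos with h0 | h0
    · rw [h0, Nat.cast_zero, Real.log_zero]
      exact_mod_cast Real.log_natCast_nonneg (c * m)
    · exact Real.log_le_log (by exact_mod_cast h0) (by exact_mod_cast h m (by omega))
  · refine le_iSup_of_le ⟨Submodule.span K {MonoidAlgebra.of K G x},
      Submodule.fg_span_singleton _⟩ ?_
    refine Filter.le_limsup_of_frequently_le' (Filter.Eventually.frequently ?_)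
    filter_upwards [Filter.eventually_ge_atTop 2] with m hm
    have hlog : 0 < Real.log m := Real.log_pos (by exact_mod_cast hm)
    have h := le_growthFun_span_of (K := K) hx m
    rw [← EReal.coe_one, EReal.coe_le_coe_iff, one_le_div hlog]
    exact Real.log_le_log (by positivity) (by exact_mod_cast (Nat.le_succ m).trans h)

end Growth

end FiniteByCyclic

/-! ### The presented group: nonintransitive input and degree map -/

section PermGroup

variable {n l : ℕ} {H : Subgroup (Equiv.Perm (Fin n))}

theorem closure_range_permGroup_of :
    Subgroup.closure (Set.range (PresentedGroup.of : Fin n → PermGroup n l H)) = ⊤ :=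
  PresentedGroup.closure_range_of _

theorem hasExponentialGrowth_permGroup (K : Type*) [Field K]
    (hH : ¬ MulAction.IsPretransitive H (Fin n)) :
    HasExponentialGrowth K (MonoidAlgebra K (PermGroup n l H)) := by
  classical
  have hab : ∃ a b : Fin n, b ∉ MulAction.orbit H a := by
    by_contra! h
    exact hH ⟨fun a b => h a b⟩
  obtain ⟨a, b, hab⟩ := hab
  have : Group.FG (PermGroup n l H) := (Group.fg_iff).2
    ⟨_, closure_range_permGroup_of, Set.finite_range _⟩
  -- Two-colouring by membership in the orbit of `a`; it is constant on `H`-orbits, so the relations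
  -- become trivial in the free group.
  let f : Fin n → Bool := fun i => decide (i ∈ MulAction.orbit H a)
  have hf : ∀ σ ∈ H, ∀ i, f (σ i) = f i := by
    intro σ hσ i
    have : σ i ∈ MulAction.orbit H a ↔ i ∈ MulAction.orbit H a := by
      rw [← MulAction.orbit_eq_iff, ← MulAction.orbit_eq_iff,
        ← MulAction.orbit_smul (⟨σ, hσ⟩ : H) i]
      rfl
    simp [f, this]
  obtain ⟨φ, hφ⟩ := exists_permGroup_hom (l := l) (H := H) (x := fun i => FreeGroup.of (f i)) (by
    intro σ hσ w _
    simp [hf σ hσ])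
  refine hasExponentialGrowth_of_freeGroup φ
    (fun t => PresentedGroup.of (if t then a else b)) fun t => ?_
  rw [hφ]
  cases t
  · simp [f, hab]
  · simp [f]

theorem exists_degree_permGroup (n l : ℕ) (H : Subgroup (Equiv.Perm (Fin n))) :
    ∃ φ : PermGroup n l H →* Multiplicative ℤ,
      ∀ i, φ (PresentedGroup.of i) = Multiplicative.ofAdd 1 :=
  exists_permGroup_hom (x := fun _ => Multiplicative.ofAdd 1) (by
    intro σ _ w _
    simp)

/-- Both kernels along `K[G] → K[ℤ] → K` are prime because the targets are domains, and `x - 1` lies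
only in the larger one. -/
theorem one_le_clKrullDim_monoidAlgebra (K : Type*) [Field K] {G : Type*} [Group G]
    (φ : G →* Multiplicative ℤ) {x : G} (hx : φ x ≠ 1) : 1 ≤ clKrullDim (MonoidAlgebra K G) := by
  refine one_le_clKrullDim_of_hom (MonoidAlgebra.mapDomainAlgHom K K φ).toRingHom
    (MonoidAlgebra.lift K K (Multiplicative ℤ) 1).toRingHom (MonoidAlgebra.of K G x - 1) ?_ ?_
  · have h := (MonoidAlgebra.of_injective (R := K) (M := Multiplicative ℤ)).ne hx
    rw [map_one] at h
    rw [map_sub, map_one, sub_ne_zero]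
    convert h
    simp
  · rw [map_sub, map_sub]
    simp [MonoidAlgebra.one_def]

end PermGroup

theorem theorem3p2 {K : Type*} [Field K] (n l : ℕ) (hn : 1 ≤ n) (hl : 2 ≤ l)
    (H : Subgroup (Equiv.Perm (Fin n))) :
    (MulAction.IsPretransitive H (Fin n) →
      IsNoetherianRing (MonoidAlgebra K (PermGroup n l H)) ∧
      IsNoetherianRing (MonoidAlgebra K (PermGroup n l H))ᵐᵒᵖ ∧
      IsPIAlgebra K (MonoidAlgebra K (PermGroup n l H)) ∧
      gkDim K (MonoidAlgebra K (PermGroup n l H)) = 1 ∧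
      clKrullDim (MonoidAlgebra K (PermGroup n l H)) = 1) ∧
    (¬ MulAction.IsPretransitive H (Fin n) →
      HasExponentialGrowth K (MonoidAlgebra K (PermGroup n l H))) := by
  refine ⟨fun hH => ?_, hasExponentialGrowth_permGroup K⟩
  obtain ⟨φ, hφ⟩ := exists_degree_permGroup n l H
  have hx := satisfiesPermRelations_of (l := l) (H := H)
  have hgen := closure_range_permGroup_of (l := l) (H := H)
  let j : Fin n := ⟨0, hn⟩
  let x : PermGroup n l H := PresentedGroup.of j
  have : Finite φ.ker := hx.finite_ker hgen (by omega) j φ hφ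
  have hpow : ∀ k : ℕ, φ (x ^ k) = Multiplicative.ofAdd (k : ℤ) := fun k => by
    rw [map_pow, hφ, ← ofAdd_nsmul, nsmul_one]
  have hne : ∀ k : ℕ, 0 < k → φ (x ^ k) ≠ 1 := fun k hk h => by
    rw [hpow, ofAdd_eq_one] at h
    omega
  have hord : ¬ IsOfFinOrder x := fun h => by
    obtain ⟨k, hk, hxk⟩ := isOfFinOrder_iff_pow_eq_one.1 h
    exact hne k hk (by rw [hxk, map_one])
  have hz : x ^ l ∈ Subgroup.center (PermGroup n l H) := hx.pow_mem_center hgen j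
  let _ := laurentAlgebra K hz
  have hfin : Module.Finite (LaurentPolynomial K) (MonoidAlgebra K (PermGroup n l H)) :=
    finite_laurentAlgebra K hz φ (hne l (by omega))
  have hnoeth := isNoetherianRing_laurentPolynomial K
  have hdim := dimensionLEOne_laurentPolynomial K
  refine ⟨IsNoetherianRing.of_finite (LaurentPolynomial K) _,
    isNoetherianRing_mulOpposite_of_finite (LaurentPolynomial K),
    isPIAlgebra_of_finite K (LaurentPolynomial K), gkDim_eq_one φ hord,
    (clKrullDim_le_one (LaurentPolynomial K)).antisymm
      (one_le_clKrullDim_monoidAlgebra K φ (x := x) ?_)⟩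
  simpa using hne 1 one_pos
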